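/- **Setting.** A *surface* $\Sigma$ is a compact (oriented) topological 2-manifold, possibly empty or disconnected, with ordered components and with a parametrization $\partial\Sigma\cong\bigsqcup^{n}S^1$ of its boundary; the $n$ boundary circles are its *holes*. A *cobordism* $M:\Sigma_s\to\Sigma_t$ consists of a compact (oriented) topological 3-manifold $M$, a partition of the holes of $-\Sigma_s\sqcup\Sigma_t$ into (ordered) pairs, and a homeomorphism $\psi^0:\Sigma^{cl}\to\partial M$, where $\Sigma^{cl}$ is the closed surface obtained from $-\Sigma_s\sqcup\Sigma_t$ by gluing in a cylinder $S^1\times[0,1]$ for each pair of holes. (Orientations play no role below and need not be assumed.) Let $\psi^s:\Sigma_s\to M$ and $\psi^t:\Sigma_t\to M$ be the restrictions of $\psi^0$. The composite $M_2\circ M_1:\Sigma_{s,1}\to\Sigma_{t,2}$ of $M_1:\Sigma_{s,1}\to\Sigma$ and $M_2:\Sigma\to\Sigma_{t,2}$ is obtained by gluing $M_1$ and $M_2$ along $\Sigma$ by means of $\psi^t_1$ and $\psi^s_2$; its cylindrical boundary parts are formed from those of $M_1$ and $M_2$, which meet at the holes of $\Sigma$. For a cobordism or a composite $M:\Sigma_s\to\Sigma_t$,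 let $\phi_0(M)$ be the space obtained by gluing full tubes $D^2\times[0,1]$ into the cylindrical boundary parts, where tubes that meet at a hole of an intermediate surface $\Sigma$ are glued to each other along their end discs; in particular, cylindrical parts of a composite that close up to a torus are filled by a solid torus. Then $\partial\phi_0(M)$ consists of $\Sigma_s$ and $\Sigma_t$ with their holes closed by the end discs of the tubes. Fix a field $k$, let $H_j(X)$ be singular homology with coefficients in $k$ and $\beta_j(X)=\dim_k H_j(X)$, and put $$\beta_0^{int}(M)=\beta_0(\phi_0(M))-\tfrac12\,\beta_0(\partial\phi_0(M)).$$ **Lemma.** Let $M_1:\Sigma_{s,1}\to\Sigma$ and $M_2:\Sigma\to\Sigma_{t,2}$ be cobordisms, and let $$W_1=\ker\bigl(H_0(\psi^t_1):H_0(\Sigma)\to H_0(M_1)\bigr),\qquad W_2=\ker\bigl(H_0(\psi^s_2):H_0(\Sigma)\to H_0(M_2)\bigr).$$ Then $$\mu_0(M_2,M_1):=\beta_0^{int}(M_2\circ M_1)-\beta_0^{int}(M_1)-\beta_0^{int}(M_2)=\dim_k(W_1\cap W_2).$$ In particular $\mu_0(M_2,M_1)$ is a non-negative integer. -/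

import Mathlib

open scoped Manifold

noncomputable section

namespace HalfProj

universe u

/-! ### Betti numbers -/

/-- Singular homology `H_j(X; k)`. -/
abbrev H (k : Type u) [Field k] (j : ℕ) (X : Type) [TopologicalSpace X] : ModuleCat.{u} k :=
  ((AlgebraicTopology.singularHomologyFunctor (ModuleCat.{u} k) j).obj (ModuleCat.of k k)).obj
    (TopCat.of X)

/-- The linear map `H_j(f) : H_j(X; k) → H_j(Y; k)` induced by a continuous map `f`. -/
def Hmap (k : Type u) [Field k] (j : ℕ) {X Y : Type} [TopologicalSpace X] [TopologicalSpace Y]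
    (f : C(X, Y)) : H k j X →ₗ[k] H k j Y :=
  (((AlgebraicTopology.singularHomologyFunctor (ModuleCat.{u} k) j).obj (ModuleCat.of k k)).map
    (TopCat.ofHom f)).hom

/-- The Betti number `β_j(X) = dim H_j(X; k)`. -/
def betti (k : Type u) [Field k] (j : ℕ) (X : Type) [TopologicalSpace X] : ℕ :=
  Module.finrank k (H k j X)

/-! ### Surfaces -/

/-- A compact topological surface with ordered components and parametrized boundary
`∂Σ ≅ ⊔ⁿ S¹`. -/
structure Surface where
  carrier : Type
  [top : TopologicalSpace carrier]
  [charted : ChartedSpace (EuclideanHalfSpace 2) carrier]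
  [t2 : T2Space carrier]
  [compact : CompactSpace carrier]
  /-- the ordering of the components -/
  order : LinearOrder (ConnectedComponents carrier)
  /-- the number `n` of holes -/
  holes : ℕ
  /-- the parametrization of the boundary -/
  param : Fin holes × Circle ≃ₜ (𝓡∂ 2).boundary carrier

attribute [instance] Surface.top Surface.charted Surface.t2 Surface.compact

instance : CoeSort Surface Type := ⟨Surface.carrier⟩

/-- The holes of `-Σ_s ⊔ Σ_t`. -/
abbrev Holes (S T : Surface) : Type := Fin S.holes ⊕ Fin T.holes

/-- The parametrized boundary circle of `-Σ_s ⊔ Σ_t` at a given hole. -/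
def holeCircle (S T : Surface) : Holes S T → Circle → S ⊕ T
  | .inl i, z => .inl (S.param (i, z))
  | .inr i, z => .inr (T.param (i, z))

/-! ### Cobordisms -/

/-- The closed unit disc. -/
abbrev Disc : Type := Metric.closedBall (0 : ℂ) 1

/-- `S¹ = ∂D² ⊆ D²`. -/
def circleToDisc (z : Circle) : Disc := ⟨z, by rw [mem_closedBall_zero_iff, Circle.norm_coe]⟩

/-- The identity of `S¹` or, if `b` is true, the reflection `z ↦ z̄`. -/
def reflCircle (b : Bool) (z : Circle) : Circle := if b then z⁻¹ else z

/-- The identity of `D²` or, if `b` is true, the reflection `z ↦ z̄`. -/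
def reflDisc (b : Bool) (d : Disc) : Disc :=
  ⟨if b then star (d : ℂ) else d, by
    have h := d.2
    rw [mem_closedBall_zero_iff] at h ⊢
    split_ifs
    · rwa [norm_star]
    · exact h⟩

/-- The end points of `[0,1]`: `0` for `false` and `1` for `true`. -/
def endpt (b : Bool) : unitInterval := if b then 1 else 0

/-- The gluing of `c` cylinders `S¹ × [0,1]` to `-Σ_s ⊔ Σ_t`. The cylinder number `i` starts at the
hole `ends (i, false)` and ends at the hole `ends (i, true)`; at its end it is glued in by the
parametrization of the hole, possibly composed with the reflection of the circle. -/
inductive ClosedUp.Rel (S T : Surface) (c : ℕ) (ends : Fin c × Bool ≃ Holes S T)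
    (refl : Fin c → Bool) :
    (S ⊕ T) ⊕ (Fin c × Circle × unitInterval) → (S ⊕ T) ⊕ (Fin c × Circle × unitInterval) → Prop
  | glue (i : Fin c) (b : Bool) (z : Circle) :
      ClosedUp.Rel S T c ends refl (.inr (i, z, endpt b))
        (.inl (holeCircle S T (ends (i, b)) (reflCircle (b && refl i) z)))

/-- The closed surface `Σ^cl = -Σ_s ⊔_{⊔S¹} (⊔ S¹ × [0,1]) ⊔_{⊔S¹} Σ_t`. -/
abbrev ClosedUp (S T : Surface) (c : ℕ) (ends : Fin c × Bool ≃ Holes S T)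
    (refl : Fin c → Bool) : Type :=
  Quot (ClosedUp.Rel S T c ends refl)

/-- A cobordism `M : Σ_s → Σ_t`: a compact topological 3-manifold, an organization of the holes
of `-Σ_s ⊔ Σ_t` into pairs, and a homeomorphism from the resulting closed surface `Σ^cl` to `∂M`. -/
structure Cobordism (S T : Surface) where
  carrier : Type
  [top : TopologicalSpace carrier]
  [charted : ChartedSpace (EuclideanHalfSpace 3) carrier]
  [t2 : T2Space carrier]
  [compact : CompactSpace carrier]
  /-- the number of cylinders -/
  cyls : ℕ
  /-- the pairing of the holes: the start and end holes of the cylinders -/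
  ends : Fin cyls × Bool ≃ Holes S T
  /-- whether the end of a cylinder is glued in with a reflection -/
  refl : Fin cyls → Bool
  /-- the homeomorphism `ψ⁰ : Σ^cl ≅ ∂M` -/
  chart : ClosedUp S T cyls ends refl ≃ₜ (𝓡∂ 3).boundary carrier

attribute [instance] Cobordism.top Cobordism.charted Cobordism.t2 Cobordism.compact

namespace Cobordism

variable {S T : Surface} (M : Cobordism S T)

/-- `ψ⁰` as a map into `M`, before passing to the quotient `Σ^cl`. -/
def chartMap : C((S ⊕ T) ⊕ (Fin M.cyls × Circle × unitInterval), M.carrier) :=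
  ⟨fun x => (M.chart (Quot.mk _ x) : M.carrier),
    continuous_subtype_val.comp (M.chart.continuous.comp continuous_quot_mk)⟩

/-- `ψˢ : -Σ_s → M`. -/
def psiS : C(S, M.carrier) :=
  M.chartMap.comp ⟨fun x => .inl (.inl x), continuous_inl.comp continuous_inl⟩

/-- `ψᵗ : Σ_t → M`. -/
def psiT : C(T, M.carrier) :=
  M.chartMap.comp ⟨fun x => .inl (.inr x), continuous_inl.comp continuous_inr⟩

/-- The cylindrical pieces of `∂M`. -/
def cyl (i : Fin M.cyls) : C(Circle × unitInterval, M.carrier) :=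
  M.chartMap.comp ⟨fun x => .inr (i, x), by fun_prop⟩

end Cobordism

/-! ### The space underlying a cobordism or a composite, the filling map, interior Betti numbers -/

/-- The data that the filling map uses: a space, the maps of the source and target surfaces, and
the cylindrical parts of the boundary, each cut into finitely many pieces `S¹ × [0,1]`. An end of
a piece lies at a hole of `-Σ_s ⊔ Σ_t` or at a seam, where it meets an end of another piece.
For a cobordism there are no seams; in a composite `M₂ ∘ M₁` over `Σ` the pieces are the cylinders
of `M₁` and `M₂`, and the seams are the holes of `Σ`. -/
structure TubedSpace (S T : Surface) where
  carrier : Type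
  [top : TopologicalSpace carrier]
  src : C(S, carrier)
  tgt : C(T, carrier)
  pieces : Type
  seams : Type
  ends : pieces → Bool → Holes S T ⊕ seams
  refl : pieces → Bool
  wall : pieces → C(Circle × unitInterval, carrier)

attribute [instance] TubedSpace.top

namespace TubedSpace

variable {S T : Surface} (X : TubedSpace S T)

/-- The disjoint union of the space, a full tube `D² × [0,1]` for every cylindrical piece, and a
disc for every seam. -/
abbrev PreFill : Type :=
  X.carrier ⊕ ((_ : X.pieces) × Disc × unitInterval) ⊕ ((_ : X.seams) × Disc)

/-- The full tubes are glued in along `S¹ × [0,1]`, and consecutive full tubes are glued to each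
other along the disc of the seam between them. -/
inductive FillRel : X.PreFill → X.PreFill → Prop
  | wall (p : X.pieces) (z : Circle) (t : unitInterval) :
      FillRel (.inr (.inl ⟨p, circleToDisc z, t⟩)) (.inl (X.wall p (z, t)))
  | seam (p : X.pieces) (b : Bool) (j : X.seams) (h : X.ends p b = .inr j) (d : Disc) :
      FillRel (.inr (.inl ⟨p, d, endpt b⟩)) (.inr (.inr ⟨j, reflDisc (b && X.refl p) d⟩))

/-- `φ_0(M)`: the space with all cylindrical parts filled by full tubes. -/
abbrev Fill : Type := Quot X.FillRel

/-- `∂φ_0(M)`: the source and target surfaces, with their holes closed by the end discs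
`D² × {0}` and `D² × {1}` of the full tubes. -/
def fillBoundary : Set X.Fill :=
  Set.range (fun x : S => Quot.mk X.FillRel (.inl (X.src x))) ∪
  Set.range (fun x : T => Quot.mk X.FillRel (.inl (X.tgt x))) ∪
  {y | ∃ (p : X.pieces) (b : Bool) (h : Holes S T) (d : Disc),
    X.ends p b = .inl h ∧ y = Quot.mk X.FillRel (.inr (.inl ⟨p, d, endpt b⟩))}

/-- The interior Betti number `β_j^int(M) = β_j(φ_0(M)) - ½ β_j(∂φ_0(M))`. -/
def bettiInt (k : Type u) [Field k] (j : ℕ) : ℚ :=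
  (betti k j X.Fill : ℚ) - 1 / 2 * (betti k j X.fillBoundary : ℚ)

end TubedSpace

/-- The space with surfaces and cylinders underlying a cobordism. -/
def Cobordism.toTubed {S T : Surface} (M : Cobordism S T) : TubedSpace S T where
  carrier := M.carrier
  src := M.psiS
  tgt := M.psiT
  pieces := Fin M.cyls
  seams := Empty
  ends := fun i b => .inl (M.ends (i, b))
  refl := M.refl
  wall := M.cyl

/-! ### Composition -/

section Composition

variable {S R T : Surface}

/-- The identification of the target surface of `M₁` with the source surface of `M₂`. -/
inductive GlueRel (M₂ : Cobordism R T) (M₁ : Cobordism S R) :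
    M₁.carrier ⊕ M₂.carrier → M₁.carrier ⊕ M₂.carrier → Prop
  | glue (x : R) : GlueRel M₂ M₁ (.inl (M₁.psiT x)) (.inr (M₂.psiS x))

/-- The 3-manifold `M₂ ⊔_Σ M₁`. -/
abbrev Glue (M₂ : Cobordism R T) (M₁ : Cobordism S R) : Type := Quot (GlueRel M₂ M₁)

/-- The inclusion of `M₁`. -/
def Glue.inl (M₂ : Cobordism R T) (M₁ : Cobordism S R) : C(M₁.carrier, Glue M₂ M₁) :=
  ⟨fun x => Quot.mk _ (.inl x), continuous_quot_mk.comp continuous_inl⟩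

/-- The inclusion of `M₂`. -/
def Glue.inr (M₂ : Cobordism R T) (M₁ : Cobordism S R) : C(M₂.carrier, Glue M₂ M₁) :=
  ⟨fun x => Quot.mk _ (.inr x), continuous_quot_mk.comp continuous_inr⟩

/-- Where a cylinder end of `M₁` lies in the composite: at a hole of the source, or at the seam
given by a hole of `Σ`. -/
def lowerEnd (S R T : Surface) : Holes S R → Holes S T ⊕ Fin R.holes
  | .inl i => .inl (.inl i)
  | .inr i => .inr i

/-- Where a cylinder end of `M₂` lies in the composite: at the seam given by a hole of `Σ`, or at
a hole of the target. -/
def upperEnd (S R T : Surface) : Holes R T → Holes S T ⊕ Fin R.holes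
  | .inl i => .inr i
  | .inr i => .inl (.inr i)

/-- The composite `M₂ ∘ M₁` over the intermediate surface `Σ`. -/
def comp (M₂ : Cobordism R T) (M₁ : Cobordism S R) : TubedSpace S T where
  carrier := Glue M₂ M₁
  src := (Glue.inl M₂ M₁).comp M₁.psiS
  tgt := (Glue.inr M₂ M₁).comp M₂.psiT
  pieces := Fin M₁.cyls ⊕ Fin M₂.cyls
  seams := Fin R.holes
  ends := Sum.elim (fun i b => lowerEnd S R T (M₁.ends (i, b)))
    (fun i b => upperEnd S R T (M₂.ends (i, b)))
  refl := Sum.elim M₁.refl M₂.refl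
  wall := Sum.elim (fun i => (Glue.inl M₂ M₁).comp (M₁.cyl i))
    (fun i => (Glue.inr M₂ M₁).comp (M₂.cyl i))

/-- `μ_0(M₂, M₁) = β_0^int(M₂ ∘ M₁) - β_0^int(M₁) - β_0^int(M₂)`. -/
def mu0 (k : Type u) [Field k] (M₂ : Cobordism R T) (M₁ : Cobordism S R) : ℚ :=
  (comp M₂ M₁).bettiInt k 0 - M₁.toTubed.bettiInt k 0 - M₂.toTubed.bettiInt k 0

/-- `W₁ = ker H_0(ψᵗ₁) ⊆ H_0(Σ)`. -/
def W1 (k : Type u) [Field k] (M₁ : Cobordism S R) : Submodule k (H k 0 R) :=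
  LinearMap.ker (Hmap k 0 M₁.psiT)

/-- `W₂ = ker H_0(ψˢ₂) ⊆ H_0(Σ)`. -/
def W2 (k : Type u) [Field k] (M₂ : Cobordism R T) : Submodule k (H k 0 R) :=
  LinearMap.ker (Hmap k 0 M₂.psiS)

end Composition

end HalfProj

end

noncomputable section

namespace HalfProj

universe u

/-! ### Path components -/

/-! In degree zero everything reduces to counting path components: `H_0(X; k)` is naturally free on
`ZerothHomotopy X` (`homologyZeroEquiv`, `homologyZeroEquiv_Hmap`), so `betti k 0` counts components
and the kernels `W1`, `W2` are kernels of maps between free modules on finite sets.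

Filling tubes is harmless. A tube is path connected and meets the space along its wall, so the
filling has the components of the space (`IsRegular.card_pi0_fill`). Capping holes by discs does not
merge or create components, so the boundary of the filling has the components of the two outer
surfaces (`IsRegular.card_pi0_fillBoundary`). Both counts are proved for the common abstraction
`TubedSpace.IsRegular`, which cobordisms and composites satisfy. In `mu0` the outer surfaces cancel
and the two halves for the middle surface add up, leaving |π₀(M₂ ∘ M₁)| - |π₀ M₁| - |π₀ M₂| + |π₀
Σ|.

The components of the glued space form the pushout P of A = π₀ M₁ and B = π₀ M₂ over I = π₀ Σ
(`card_pi0_pushout`). The exact sequence 0 → W₁ ∩ W₂ → k[I] → k[A ⊔ B] → k[P] → 0 then identifies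
this number with the dimension of W₁ ∩ W₂ (`finrank_ker_inf_ker`). -/

/-- The map induced on path components by a continuous map. -/
def pi0Map {X Y : Type*} [TopologicalSpace X] [TopologicalSpace Y] (f : C(X, Y)) :
    ZerothHomotopy X → ZerothHomotopy Y :=
  ZerothHomotopy.lift (fun x => .mk (f x)) fun _ _ p => ZerothHomotopy.sound (p.map f.continuous)

@[simp]
lemma pi0Map_mk {X Y : Type*} [TopologicalSpace X] [TopologicalSpace Y] (f : C(X, Y)) (x : X) :
    pi0Map f (.mk x) = .mk (f x) := rfl

/-! ### Singular homology in degree zero -/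

section HomologyZero

open CategoryTheory Limits Simplicial

variable (k : Type u) [Field k]

/-- The coproduct of copies of `k` is the free module on the index set. -/
def sigmaIsoFinsupp (ι : Type) :
    (∐ fun _ : ι => ModuleCat.of k k) ≅ ModuleCat.of k (ι →₀ k) where
  hom := Sigma.desc fun i => ModuleCat.ofHom (Finsupp.lsingle i)
  inv := ModuleCat.ofHom (Finsupp.lsum k fun i => (Sigma.ι (fun _ : ι => ModuleCat.of k k) i).hom)
  hom_inv_id := by
    ext i : 1
    ext
    simp
  inv_hom_id := by
    ext i : 3
    ext
    simp

lemma ι_sigmaIsoFinsupp_hom_apply (ι : Type) (i : ι) (a : k) :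
    (sigmaIsoFinsupp k ι).hom (Sigma.ι (fun _ : ι => ModuleCat.of k k) i a) =
      Finsupp.single i a := by
  have h : Sigma.ι (fun _ : ι => ModuleCat.of k k) i ≫ (sigmaIsoFinsupp k ι).hom =
      ModuleCat.ofHom (Finsupp.lsingle i) := by
    simp [sigmaIsoFinsupp]
  exact congr($h a)

/-- The homology class of a vertex of a simplicial set, as a morphism from the coefficients. -/
def vertexClassHom {Z : SSet.{0}} (z : Z _⦋0⦌) :
    ModuleCat.of k k ⟶ Z.homology (ModuleCat.of k k) 0 :=
  (Z.chainComplex (ModuleCat.of k k)).liftCycles (Z.ιChainComplex z) 0 (by simp) (by simp) ≫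
    (Z.chainComplex (ModuleCat.of k k)).homologyπ 0

lemma vertexClassHom_map {Y Z : SSet.{0}} (f : Y ⟶ Z) (y : Y _⦋0⦌) :
    vertexClassHom k y ≫ SSet.homologyMap f (ModuleCat.of k k) 0 =
      vertexClassHom k (f.app _ y) := by
  rw [vertexClassHom, Category.assoc, HomologicalComplex.homologyπ_naturality,
    HomologicalComplex.liftCycles_comp_cyclesMap_assoc, vertexClassHom]
  simp only [SSet.ι_chainComplexMap_f]

/-- The homology of a simplicial set in degree zero is free on its components. -/
def simplicialHomologyZeroEquiv (Z : SSet.{0}) :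
    (Z.homology (ModuleCat.of k k) 0 : ModuleCat.{u} k) ≃ₗ[k] (Z.π₀ →₀ k) :=
  (Z.homology₀Iso (ModuleCat.of k k) ≪≫ sigmaIsoFinsupp k Z.π₀).toLinearEquiv

lemma simplicialHomologyZeroEquiv_vertexClassHom {Z : SSet.{0}} (z : Z _⦋0⦌) (a : k) :
    simplicialHomologyZeroEquiv k Z (vertexClassHom k z a) = Finsupp.single (.mk z) a := by
  have h : vertexClassHom k z ≫ (Z.homology₀Iso (ModuleCat.of k k)).hom =
      Sigma.ι (fun _ : Z.π₀ => ModuleCat.of k k) (.mk z) := by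
    rw [vertexClassHom, Category.assoc]
    exact SSet.liftCycles_ιChainComplex_homologyπ_homology₀Iso_hom Z (ModuleCat.of k k) z
  have h' : (Z.homology₀Iso (ModuleCat.of k k)).hom (vertexClassHom k z a) =
      Sigma.ι (fun _ : Z.π₀ => ModuleCat.of k k) (.mk z) a := congr($h a)
  rw [← ι_sigmaIsoFinsupp_hom_apply, ← h']
  rfl

/-- The homology class of a point, with a coefficient. -/
def pointClass {X : Type} [TopologicalSpace X] (x : X) (a : k) : H k 0 X :=
  vertexClassHom k (Z := TopCat.toSSet.obj (TopCat.of X)) (TopCat.toSSetObj₀Equiv.symm x) a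

lemma Hmap_pointClass {X Y : Type} [TopologicalSpace X] [TopologicalSpace Y] (f : C(X, Y))
    (x : X) (a : k) : Hmap k 0 f (pointClass k x a) = pointClass k (f x) a :=
  congr($(vertexClassHom_map k (TopCat.toSSet.map (TopCat.ofHom f))
    (TopCat.toSSetObj₀Equiv.symm x)) a)

/-- `H_0(X; k)` is free on the path components of `X`. -/
def homologyZeroEquiv (X : Type) [TopologicalSpace X] : H k 0 X ≃ₗ[k] (ZerothHomotopy X →₀ k) :=
  (simplicialHomologyZeroEquiv k (TopCat.toSSet.obj (TopCat.of X))).trans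
    (Finsupp.domLCongr (TopCat.zerothHomotopyEquiv (X := TopCat.of X)).symm)

lemma homologyZeroEquiv_pointClass {X : Type} [TopologicalSpace X] (x : X) (a : k) :
    homologyZeroEquiv k X (pointClass k x a) = Finsupp.single (.mk x) a := by
  have h := simplicialHomologyZeroEquiv_vertexClassHom k
    (Z := TopCat.toSSet.obj (TopCat.of X)) (TopCat.toSSetObj₀Equiv.symm x) a
  refine (congrArg (Finsupp.domLCongr (R := k)
    (TopCat.zerothHomotopyEquiv (X := TopCat.of X)).symm) h).trans ?_
  rw [Finsupp.domLCongr_single, TopCat.zerothHomotopyEquiv_symm_mk, Equiv.apply_symm_apply]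

/-- Both sides are linear and point classes span, so it suffices that `f` carries the class of a
point to the class of its image. -/
lemma homologyZeroEquiv_Hmap {X Y : Type} [TopologicalSpace X] [TopologicalSpace Y] (f : C(X, Y))
    (a : H k 0 X) :
    homologyZeroEquiv k Y (Hmap k 0 f a) =
      Finsupp.lmapDomain k k (pi0Map f) (homologyZeroEquiv k X a) := by
  obtain ⟨v, rfl⟩ := (homologyZeroEquiv k X).symm.surjective a
  rw [LinearEquiv.apply_symm_apply]
  induction v using Finsupp.induction_linear with
  | zero => simp
  | add v w hv hw => simp only [map_add, hv, hw]
  | single i a =>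
    induction i with | mk x =>
    rw [← homologyZeroEquiv_pointClass, LinearEquiv.symm_apply_apply, Hmap_pointClass,
      homologyZeroEquiv_pointClass, homologyZeroEquiv_pointClass]
    simp

/-- No finiteness is needed: for infinitely many components both sides take the default value 0. -/
lemma betti_zero (X : Type) [TopologicalSpace X] : betti k 0 X = Nat.card (ZerothHomotopy X) := by
  rw [betti, (homologyZeroEquiv k X).finrank_eq, Module.finrank, rank_finsupp_self]
  simp [Nat.card]

end HomologyZero

/-! ### Linear algebra of pushouts of sets -/

section Pushout

variable {I A B : Type*}

/-- The identification of the images of `I` in a disjoint union `A ⊔ B`. -/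
inductive PushoutRel (a : I → A) (b : I → B) : A ⊕ B → A ⊕ B → Prop
  | glue (i : I) : PushoutRel a b (.inl (a i)) (.inr (b i))

variable (k : Type*) [Field k]

/-- Once the differences of related generators lie in `N`, the projection modulo `N` factors through
the free module on `Quot r`. -/
lemma ker_lmapDomain_quot_mk_le {X : Type*} (r : X → X → Prop) (N : Submodule k (X →₀ k))
    (hN : ∀ x y, r x y → Finsupp.single x (1 : k) - Finsupp.single y 1 ∈ N) :
    LinearMap.ker (Finsupp.lmapDomain k k (Quot.mk r)) ≤ N := by
  let g : (Quot r →₀ k) →ₗ[k] (X →₀ k) ⧸ N := Finsupp.linearCombination k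
    (Quot.lift (fun x => N.mkQ (Finsupp.single x 1)) fun x y h => by
      rw [← sub_eq_zero, ← map_sub]
      exact (Submodule.Quotient.mk_eq_zero N).2 (hN x y h))
  have hg : g ∘ₗ Finsupp.lmapDomain k k (Quot.mk r) = N.mkQ := by
    ext x
    simp [g]
  intro v hv
  rw [← N.ker_mkQ, LinearMap.mem_ker, ← hg, LinearMap.comp_apply, LinearMap.mem_ker.1 hv, map_zero]

/-- The signed difference of the two maps induced on free modules. -/
def pushoutDiff (a : I → A) (b : I → B) : (I →₀ k) →ₗ[k] (A ⊕ B →₀ k) :=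
  Finsupp.lmapDomain k k (Sum.inl ∘ a) - Finsupp.lmapDomain k k (Sum.inr ∘ b)

/-- The two terms are supported on disjoint summands of `A ⊕ B`, so they cannot cancel each other.
-/
lemma ker_pushoutDiff (a : I → A) (b : I → B) :
    LinearMap.ker (pushoutDiff k a b) =
      LinearMap.ker (Finsupp.lmapDomain k k a) ⊓ LinearMap.ker (Finsupp.lmapDomain k k b) := by
  ext v
  simp only [pushoutDiff, LinearMap.mem_ker, LinearMap.sub_apply, Finsupp.lmapDomain_apply,
    Submodule.mem_inf, Finsupp.mapDomain_comp]
  constructor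
  · intro h
    rw [sub_eq_zero] at h
    constructor
    · ext x
      rw [← Finsupp.mapDomain_apply Sum.inl_injective, h,
        Finsupp.mapDomain_of_notMem_range _ _ (by simp)]
      rfl
    · ext x
      rw [← Finsupp.mapDomain_apply Sum.inr_injective, ← h,
        Finsupp.mapDomain_of_notMem_range _ _ (by simp)]
      rfl
  · rintro ⟨ha, hb⟩
    simp [ha, hb]

/-- Exactness in the middle of the Mayer-Vietoris sequence. -/
lemma range_pushoutDiff (a : I → A) (b : I → B) :
    LinearMap.range (pushoutDiff k a b) =
      LinearMap.ker (Finsupp.lmapDomain k k (Quot.mk (PushoutRel a b))) := by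
  apply le_antisymm
  · rw [LinearMap.range_le_ker_iff]
    ext i : 2
    have h : Quot.mk (PushoutRel a b) (.inl (a i)) = Quot.mk _ (.inr (b i)) := Quot.sound (.glue i)
    have h' : pushoutDiff k a b (Finsupp.single i 1) =
        Finsupp.single (.inl (a i)) 1 - Finsupp.single (.inr (b i)) 1 := by
      simp [pushoutDiff]
    simp only [LinearMap.comp_apply, Finsupp.lsingle_apply, h', map_sub, Finsupp.lmapDomain_apply,
      Finsupp.mapDomain_single, h, sub_self, LinearMap.zero_apply]
  · refine ker_lmapDomain_quot_mk_le k _ _ ?_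
    rintro _ _ ⟨i⟩
    exact ⟨Finsupp.single i 1, by simp [pushoutDiff]⟩

/-- The tail of the Mayer-Vietoris sequence for a pushout of finite sets. -/
lemma finrank_ker_inf_ker [Finite I] [Finite A] [Finite B] (a : I → A) (b : I → B) :
    Module.finrank k ↥(LinearMap.ker (Finsupp.lmapDomain k k a) ⊓
        LinearMap.ker (Finsupp.lmapDomain k k b)) + (Nat.card A + Nat.card B) =
      Nat.card (Quot (PushoutRel a b)) + Nat.card I := by
  have e1 := (pushoutDiff k a b).finrank_range_add_finrank_ker
  have e2 := (Finsupp.lmapDomain k k (Quot.mk (PushoutRel a b))).finrank_range_add_finrank_ker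
  have hs : Function.Surjective (Finsupp.lmapDomain k k (Quot.mk (PushoutRel a b))) :=
    Finsupp.mapDomain_surjective Quot.mk_surjective
  rw [LinearMap.range_eq_top.2 hs, finrank_top, ← range_pushoutDiff,
    Module.finrank_eq_nat_card_basis
      (Finsupp.basisSingleOne (R := k) (ι := Quot (PushoutRel a b))),
    Module.finrank_eq_nat_card_basis (Finsupp.basisSingleOne (R := k) (ι := A ⊕ B)),
    Nat.card_sum] at e2
  rw [ker_pushoutDiff,
    Module.finrank_eq_nat_card_basis (Finsupp.basisSingleOne (R := k) (ι := I))] at e1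
  omega

end Pushout

/-! ### Counting path components -/

section Components

variable {X Y : Type*} [TopologicalSpace X] [TopologicalSpace Y]

lemma pi0_mk_eq_of_pathConnected [PathConnectedSpace Y] {f : Y → X} (hf : Continuous f)
    (y y' : Y) : ZerothHomotopy.mk (f y) = ZerothHomotopy.mk (f y') :=
  congrArg (pi0Map ⟨f, hf⟩) (Subsingleton.elim (ZerothHomotopy.mk y) (ZerothHomotopy.mk y'))

/-- A continuous surjection onto a discrete space whose fibres lie in single path components
identifies the set of path components. -/
lemma card_pi0_eq {P : Type*} [TopologicalSpace P] [DiscreteTopology P] (f : X → P)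
    (hf : Continuous f) (hs : Function.Surjective f) (g : P → ZerothHomotopy X)
    (hg : ∀ x, g (f x) = .mk x) : Nat.card (ZerothHomotopy X) = Nat.card P := by
  refine Nat.card_congr
    { toFun := ZerothHomotopy.lift f fun x y p => ?_
      invFun := g
      left_inv := fun c => ?_
      right_inv := fun c => ?_ }
  -- A continuous map to a discrete space is constant along a path.
  · simpa using (((IsLocallyConstant.iff_continuous _).2 hf).comp_continuous
      p.continuous).apply_eq_of_preconnectedSpace 0 1
  · induction c with | mk x => exact hg x
  · obtain ⟨x, rfl⟩ := hs c
    rw [hg, ZerothHomotopy.lift_mk]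

lemma continuous_pi0_mk : Continuous (ZerothHomotopy.mk : X → ZerothHomotopy X) :=
  ZerothHomotopy.isQuotientMap_mk.continuous

lemma card_pi0_sum [LocallyPathConnectedSpace X] [LocallyPathConnectedSpace Y] :
    Nat.card (ZerothHomotopy (X ⊕ Y)) =
      Nat.card (ZerothHomotopy X ⊕ ZerothHomotopy Y) := by
  refine card_pi0_eq (Sum.map .mk .mk) (continuous_pi0_mk.sumMap continuous_pi0_mk)
    (ZerothHomotopy.mk_surjective.sumMap ZerothHomotopy.mk_surjective)
    (Sum.elim (pi0Map ⟨Sum.inl, continuous_inl⟩) (pi0Map ⟨Sum.inr, continuous_inr⟩)) ?_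
  rintro (x | y) <;> rfl

/-- The path components of a pushout of locally path connected spaces. -/
lemma card_pi0_pushout {Z : Type*} [TopologicalSpace Z] [LocallyPathConnectedSpace X]
    [LocallyPathConnectedSpace Y] (a : C(Z, X)) (b : C(Z, Y)) :
    Nat.card (ZerothHomotopy (Quot (PushoutRel a b))) =
      Nat.card (Quot (PushoutRel (pi0Map a) (pi0Map b))) := by
  let P := Quot (PushoutRel (pi0Map a) (pi0Map b))
  -- Local path connectedness makes the component sets of `X` and `Y` discrete, so giving their
  -- pushout the discrete topology keeps the comparison map continuous.
  let : TopologicalSpace P := ⊥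
  have : DiscreteTopology P := ⟨rfl⟩
  let f : Quot (PushoutRel a b) → P :=
    Quot.lift (fun x => Quot.mk _ (Sum.map .mk .mk x)) (by
      rintro _ _ ⟨z⟩
      exact Quot.sound (.glue (ZerothHomotopy.mk z)))
  let jX : C(X, Quot (PushoutRel a b)) :=
    ⟨fun x => Quot.mk _ (.inl x), continuous_quot_mk.comp continuous_inl⟩
  let jY : C(Y, Quot (PushoutRel a b)) :=
    ⟨fun x => Quot.mk _ (.inr x), continuous_quot_mk.comp continuous_inr⟩
  refine card_pi0_eq (P := P) f ?_ ?_ (Quot.lift (Sum.elim (pi0Map jX) (pi0Map jY)) ?_) ?_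
  · exact continuous_quot_lift _
      ((continuous_of_discreteTopology (f := Quot.mk (PushoutRel (pi0Map a) (pi0Map b)))).comp
        (continuous_pi0_mk.sumMap continuous_pi0_mk))
  · rintro ⟨c⟩
    obtain ⟨x, rfl⟩ := ZerothHomotopy.mk_surjective.sumMap ZerothHomotopy.mk_surjective c
    exact ⟨Quot.mk _ x, rfl⟩
  · rintro _ _ ⟨c⟩
    induction c with | mk z => exact congrArg ZerothHomotopy.mk (Quot.sound (.glue z))
  · rintro ⟨x | y⟩ <;> rfl

end Components

/-! ### Circles, discs and intervals -/

instance pathConnectedSpace_circle : PathConnectedSpace Circle := by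
  have : Function.Surjective Circle.exp := Circle.exp_surjective
  exact this.pathConnectedSpace Circle.exp.continuous

instance pathConnectedSpace_disc : PathConnectedSpace Disc :=
  isPathConnected_iff_pathConnectedSpace.1
    ((convex_closedBall (0 : ℂ) 1).isPathConnected ⟨0, by simp⟩)

instance pathConnectedSpace_unitInterval : PathConnectedSpace unitInterval :=
  isPathConnected_iff_pathConnectedSpace.1
    ((convex_Icc (0 : ℝ) 1).isPathConnected ⟨0, by simp⟩)

lemma continuous_circleToDisc : Continuous circleToDisc :=
  Continuous.subtype_mk (by fun_prop) _

lemma circleToDisc_injective : Function.Injective circleToDisc := fun _ _ h =>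
  Circle.ext (congrArg (Subtype.val : Disc → ℂ) h)

lemma endpt_injective : Function.Injective endpt := by
  intro b c
  cases b <;> cases c <;> simp [endpt]

@[simp]
lemma reflCircle_one (b : Bool) : reflCircle b 1 = 1 := by
  cases b <;> simp [reflCircle]

lemma continuous_holeCircle (S T : Surface) (h : Holes S T) : Continuous (holeCircle S T h) := by
  cases h with
  | inl i => exact continuous_inl.comp (continuous_subtype_val.comp (by fun_prop))
  | inr i => exact continuous_inr.comp (continuous_subtype_val.comp (by fun_prop))

instance Surface.locallyPathConnectedSpace (S : Surface) : LocallyPathConnectedSpace S :=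
  ChartedSpace.locallyPathConnectedSpace (EuclideanHalfSpace 2) S

instance Cobordism.locallyPathConnectedSpace {S T : Surface} (M : Cobordism S T) :
    LocallyPathConnectedSpace M.carrier :=
  ChartedSpace.locallyPathConnectedSpace (EuclideanHalfSpace 3) M.carrier

/-! ### Path components of the filled space -/

namespace TubedSpace

variable {S T : Surface} (X : TubedSpace S T)

/-- The surfaces are embedded disjointly, the cylinders start and end at the prescribed holes and
do not meet the surfaces at seams, and the cylinders that meet at a seam lie in one path
component. -/
structure IsRegular : Prop where
  locallyPathConnected : LocallyPathConnectedSpace X.carrier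
  isClosedEmbedding : Topology.IsClosedEmbedding (Sum.elim X.src X.tgt : S ⊕ T → X.carrier)
  wall_hole : ∀ p b h, X.ends p b = .inl h → ∀ z, X.wall p (z, endpt b) =
    Sum.elim X.src X.tgt (holeCircle S T h (reflCircle (b && X.refl p) z))
  wall_seam : ∀ p b j, X.ends p b = .inr j → ∀ z y, Sum.elim X.src X.tgt y ≠ X.wall p (z, endpt b)
  exists_end : ∀ j, ∃ p b, X.ends p b = .inr j
  seam_joined : ∀ j, ∃ x, ∀ p b, X.ends p b = .inr j →
    ZerothHomotopy.mk (X.wall p (1, endpt b)) = ZerothHomotopy.mk x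

variable {X}

/-- The inclusion of the space into its filling. -/
def toFill (X : TubedSpace S T) : C(X.carrier, X.Fill) :=
  ⟨fun x => Quot.mk _ (.inl x), continuous_quot_mk.comp continuous_inl⟩

/-- The full tubes in the filling. -/
def tube (X : TubedSpace S T) (p : X.pieces) : C(Disc × unitInterval, X.Fill) :=
  ⟨fun q => Quot.mk _ (.inr (.inl ⟨p, q⟩)),
    continuous_quot_mk.comp (continuous_inr.comp (continuous_inl.comp continuous_sigmaMk))⟩

lemma tube_circle (p : X.pieces) (z : Circle) (t : unitInterval) :
    X.tube p (circleToDisc z, t) = X.toFill (X.wall p (z, t)) :=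
  Quot.sound (.wall p z t)

lemma pi0_mk_tube (p : X.pieces) (q : Disc × unitInterval) (z : Circle) (t : unitInterval) :
    ZerothHomotopy.mk (X.tube p q) = ZerothHomotopy.mk (X.toFill (X.wall p (z, t))) := by
  rw [← tube_circle]
  exact pi0_mk_eq_of_pathConnected (X.tube p).continuous _ _

/-- Filling the tubes does not change the path components. -/
lemma IsRegular.card_pi0_fill (hX : X.IsRegular) :
    Nat.card (ZerothHomotopy X.Fill) = Nat.card (ZerothHomotopy X.carrier) := by
  have := hX.locallyPathConnected
  choose s hs using hX.seam_joined
  have hw (p : X.pieces) (y y' : Circle × unitInterval) :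
      ZerothHomotopy.mk (X.wall p y) = ZerothHomotopy.mk (X.wall p y') :=
    pi0_mk_eq_of_pathConnected (X.wall p).continuous _ _
  -- A retraction on components: a tube goes to the component of its wall, a seam disc to the common
  -- component of the walls meeting there.
  let f₀ : X.PreFill → ZerothHomotopy X.carrier :=
    Sum.elim .mk (Sum.elim (fun q => .mk (X.wall q.1 (1, 0))) fun q => .mk (s q.1))
  have hf₀ : Continuous f₀ := by
    refine continuous_pi0_mk.sumElim (.sumElim ?_ ?_)
    · exact continuous_sigma fun p => continuous_const (y := ZerothHomotopy.mk (X.wall p (1, 0)))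
    · exact continuous_sigma fun j => continuous_const (y := ZerothHomotopy.mk (s j))
  let f : X.Fill → ZerothHomotopy X.carrier := Quot.lift f₀ (by
    rintro _ _ (⟨p, z, t⟩ | ⟨p, b, j, h, d⟩)
    · exact hw p _ _
    · exact (hw p _ _).trans (hs j p b h))
  refine card_pi0_eq f (continuous_quot_lift _ hf₀) (fun c => ?_) (pi0Map X.toFill) ?_
  · induction c with | mk x => exact ⟨X.toFill x, rfl⟩
  · rintro ⟨x | ⟨p, q⟩ | ⟨j, d⟩⟩
    · rfl
    · exact (pi0_mk_tube p q 1 0).symm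
    · obtain ⟨p, b, h⟩ := hX.exists_end j
      -- The reflection is an involution, so `d` is glued to the reflected point of the end disc of
      -- a tube.
      have hd : reflDisc (b && X.refl p) (reflDisc (b && X.refl p) d) = d := by
        apply Subtype.ext
        cases b && X.refl p <;> simp [reflDisc]
      have h1 := Quot.sound (FillRel.seam p b j h (reflDisc (b && X.refl p) d))
      rw [hd] at h1
      refine Eq.trans ?_ (congrArg ZerothHomotopy.mk h1)
      exact (congrArg (pi0Map X.toFill) (hs j p b h)).symm.trans (pi0_mk_tube p _ _ _).symm

/-- The part of the filled space that belongs to a component of `-Σ_s ⊔ Σ_t`: the component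
itself and the end discs at its holes, before gluing. -/
def prePart (X : TubedSpace S T) (c : ZerothHomotopy (S ⊕ T)) : X.PreFill → Prop :=
  Sum.elim (fun x => ∃ y, .mk y = c ∧ Sum.elim X.src X.tgt y = x) <| Sum.elim
    -- This alternative lets the predicate descend along the wall gluing: regularity does not forbid
    -- a wall to meet the surfaces away from its ends.
    (fun q => (∃ z y, .mk y = c ∧ circleToDisc z = q.2.1 ∧
        Sum.elim X.src X.tgt y = X.wall q.1 (z, q.2.2)) ∨
      ∃ b, q.2.2 = endpt b ∧ ∃ h, X.ends q.1 b = .inl h ∧ .mk (holeCircle S T h 1) = c)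
    fun _ => False

lemma pi0_mk_holeCircle (h : Holes S T) (z z' : Circle) :
    ZerothHomotopy.mk (holeCircle S T h z) = ZerothHomotopy.mk (holeCircle S T h z') :=
  pi0_mk_eq_of_pathConnected (continuous_holeCircle S T h) z z'

lemma IsRegular.prePart_wall (hX : X.IsRegular) (c : ZerothHomotopy (S ⊕ T)) (p : X.pieces)
    (z : Circle) (t : unitInterval) :
    X.prePart c (.inr (.inl ⟨p, circleToDisc z, t⟩)) ↔ X.prePart c (.inl (X.wall p (z, t))) := by
  constructor
  · rintro (⟨z', y, hy, hz, h⟩ | ⟨b, hb, h, hh, hc⟩)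
    · cases circleToDisc_injective hz
      exact ⟨y, hy, h⟩
    · obtain rfl : t = endpt b := hb
      exact ⟨_, (pi0_mk_holeCircle _ _ _).trans hc, (hX.wall_hole p b h hh z).symm⟩
  · rintro ⟨y, hy, h⟩
    exact .inl ⟨z, y, hy, rfl, h⟩

/-- The part of the filled space that belongs to a component of `-Σ_s ⊔ Σ_t`. -/
def IsRegular.part (hX : X.IsRegular) (c : ZerothHomotopy (S ⊕ T)) : X.Fill → Prop :=
  Quot.lift (X.prePart c) (by
    rintro _ _ (⟨p, z, t⟩ | ⟨p, b, j, h, d⟩)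
    · exact propext (hX.prePart_wall c p z t)
    · refine eq_false ?_
      rintro (⟨z, y, -, -, hy⟩ | ⟨b', hb, h', hh, -⟩)
      · exact hX.wall_seam p b j h z y hy
      · cases endpt_injective hb
        exact absurd (h.symm.trans hh) (by simp))

/-- Points of the space are settled by injectivity of the surfaces, and wall points reduce to them.
For other points of an end disc, the end of the tube determines the hole. -/
lemma IsRegular.part_unique (hX : X.IsRegular) {c c' : ZerothHomotopy (S ⊕ T)} {x : X.Fill}
    (h : hX.part c x) (h' : hX.part c' x) : c = c' := by
  have key (x : X.carrier) (h : X.prePart c (.inl x)) (h' : X.prePart c' (.inl x)) : c = c' := by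
    obtain ⟨y, rfl, rfl⟩ := h
    obtain ⟨y', rfl, hy⟩ := h'
    rw [hX.isClosedEmbedding.injective hy]
  obtain ⟨x | ⟨p, d, t⟩ | q⟩ := x
  · exact key x h h'
  · rcases id h with ⟨z, y, -, hz, -⟩ | ⟨b, hb, e, he, hc⟩
    · obtain rfl : circleToDisc z = d := hz
      exact key _ ((hX.prePart_wall ..).1 h) ((hX.prePart_wall ..).1 h')
    · rcases id h' with ⟨z, y, -, hz, -⟩ | ⟨b', hb', e', he', hc'⟩
      · obtain rfl : circleToDisc z = d := hz
        exact key _ ((hX.prePart_wall ..).1 h) ((hX.prePart_wall ..).1 h')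
      · cases endpt_injective (hb.symm.trans hb')
        cases he.symm.trans he'
        exact hc.symm.trans hc'
  · exact h.elim

lemma IsRegular.exists_part (hX : X.IsRegular) {x : X.Fill} (hx : x ∈ X.fillBoundary) :
    ∃ c, hX.part c x := by
  rcases hx with (⟨y, rfl⟩ | ⟨y, rfl⟩) | ⟨p, b, h, d, hh, rfl⟩
  · exact ⟨_, .inl y, rfl, rfl⟩
  · exact ⟨_, .inr y, rfl, rfl⟩
  · exact ⟨_, .inr ⟨b, rfl, h, hh, rfl⟩⟩

/-- Closedness is tested on the pieces before gluing. Inside a tube the part is a compact image of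
wall points together with at most two end discs. -/
lemma IsRegular.isClosed_part (hX : X.IsRegular) (c : ZerothHomotopy (S ⊕ T)) :
    IsClosed {x | hX.part c x} := by
  have hc : IsClosed {x | X.prePart c (.inl x)} :=
    hX.isClosedEmbedding.isClosedMap _ ((isClosed_discrete {c}).preimage continuous_pi0_mk)
  rw [← isQuotientMap_quot_mk.isClosed_preimage, isClosed_sum_iff, isClosed_sum_iff,
    isClosed_sigma_iff, isClosed_sigma_iff]
  refine ⟨hc, fun p => ?_, fun j => isClosed_empty⟩
  have h1 : IsClosed (Prod.map circleToDisc id ''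
      (X.wall p ⁻¹' {x | X.prePart c (.inl x)}) : Set (Disc × unitInterval)) :=
    (((hc.preimage (X.wall p).continuous).isCompact).image
      (continuous_circleToDisc.prodMap continuous_id)).isClosed
  have h2 : IsClosed (⋃ b : Bool, {q : Disc × unitInterval | q.2 = endpt b ∧
      ∃ h, X.ends p b = .inl h ∧ .mk (holeCircle S T h 1) = c}) :=
    isClosed_iUnion_of_finite fun b =>
      (isClosed_eq continuous_snd continuous_const).and isClosed_const
  convert h1.union h2 using 1
  ext ⟨d, t⟩
  refine or_congr ?_ (by simp)
  constructor
  · rintro ⟨z, y, hy, hz, h⟩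
    exact ⟨(z, t), ⟨y, hy, h⟩, Prod.ext hz rfl⟩
  · rintro ⟨⟨z, t'⟩, ⟨y, hy, h⟩, hz⟩
    cases hz
    exact ⟨z, y, hy, rfl, h⟩

lemma toFill_mem_fillBoundary (X : TubedSpace S T) (y : S ⊕ T) :
    X.toFill (Sum.elim X.src X.tgt y) ∈ X.fillBoundary := by
  rcases y with y | y
  · exact .inl (.inl ⟨y, rfl⟩)
  · exact .inl (.inr ⟨y, rfl⟩)

/-- The surfaces as part of the boundary of the filled space. -/
def toFillBoundary (X : TubedSpace S T) : C(S ⊕ T, X.fillBoundary) where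
  toFun y := ⟨X.toFill (Sum.elim X.src X.tgt y), X.toFill_mem_fillBoundary y⟩
  continuous_toFun := (X.toFill.continuous.comp
    (X.src.continuous.sumElim X.tgt.continuous)).subtype_mk _

lemma IsRegular.pi0Map_toFillBoundary (hX : X.IsRegular) {c : ZerothHomotopy (S ⊕ T)}
    (x : X.fillBoundary) (h : hX.part c x) : pi0Map X.toFillBoundary c = .mk x := by
  obtain ⟨⟨x | ⟨p, d, t⟩ | q⟩, hx⟩ := x
  · obtain ⟨y, rfl, rfl⟩ := h
    rfl
  · rcases h with ⟨z, y, rfl, hz, hy⟩ | ⟨b, hb, e, he, rfl⟩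
    · obtain rfl : circleToDisc z = d := hz
      refine congrArg ZerothHomotopy.mk (Subtype.ext ?_)
      exact (congrArg X.toFill hy).trans (tube_circle p z t).symm
    · obtain rfl : t = endpt b := hb
      let D : Disc → X.fillBoundary := fun d =>
        ⟨X.tube p (d, endpt b), .inr ⟨p, b, e, d, he, rfl⟩⟩
      have hD : Continuous D := ((X.tube p).continuous.comp (by fun_prop)).subtype_mk _
      refine Eq.trans ?_ (pi0_mk_eq_of_pathConnected hD (circleToDisc 1) d)
      refine congrArg ZerothHomotopy.mk (Subtype.ext ?_)
      refine Eq.trans ?_ (tube_circle p 1 (endpt b)).symm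
      rw [hX.wall_hole p b e he, reflCircle_one]
      rfl
  · exact h.elim

/-- The path components of the boundary of the filled space are those of the surfaces. -/
lemma IsRegular.card_pi0_fillBoundary (hX : X.IsRegular) :
    Nat.card (ZerothHomotopy X.fillBoundary) =
      Nat.card (ZerothHomotopy S) + Nat.card (ZerothHomotopy T) := by
  choose f hf using fun x : X.fillBoundary => hX.exists_part x.2
  rw [← Nat.card_sum, ← card_pi0_sum]
  refine card_pi0_eq f ?_ (fun c => ?_) (pi0Map X.toFillBoundary)
    fun x => hX.pi0Map_toFillBoundary x (hf x)
  -- The surfaces have finitely many components, so every preimage is a finite union of closed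
  -- parts.
  · refine continuous_iff_isClosed.2 fun s _ => ?_
    have : f ⁻¹' s = ⋃ c ∈ s, {x : X.fillBoundary | hX.part c x} := by
      ext x
      simp only [Set.mem_preimage, Set.mem_iUnion, Set.mem_ofPred_eq, exists_prop]
      exact ⟨fun h => ⟨_, h, hf x⟩, fun ⟨c, hc, h⟩ => hX.part_unique h (hf x) ▸ hc⟩
    rw [this]
    exact s.toFinite.isClosed_biUnion fun c _ =>
      (hX.isClosed_part c).preimage continuous_subtype_val
  · induction c with | mk y =>
    exact ⟨X.toFillBoundary y, hX.part_unique (hf _) ⟨y, rfl, rfl⟩⟩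

lemma IsRegular.bettiInt_zero (hX : X.IsRegular) (k : Type u) [Field k] :
    X.bettiInt k 0 = Nat.card (ZerothHomotopy X.carrier) -
      1 / 2 * (Nat.card (ZerothHomotopy S) + Nat.card (ZerothHomotopy T)) := by
  rw [bettiInt, betti_zero, betti_zero, hX.card_pi0_fill, hX.card_pi0_fillBoundary]
  push_cast
  rfl

end TubedSpace

/-! ### Cobordisms and composites are regular -/

/-- The surfaces inject into the closed surface. -/
lemma ClosedUp.mk_inl_injective {S T : Surface} {c : ℕ} {ends : Fin c × Bool ≃ Holes S T}
    {refl : Fin c → Bool} {x y : S ⊕ T}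
    (h : Quot.mk (ClosedUp.Rel S T c ends refl) (.inl x) = Quot.mk _ (.inl y)) : x = y := by
  -- `P` describes the gluing class of `y`: the point itself and the cylinder ends glued to it.
  let P : ClosedUp S T c ends refl → Prop := Quot.lift
    (Sum.elim (fun x' => x' = y) fun q => ∃ b, q.2.2 = endpt b ∧
      holeCircle S T (ends (q.1, b)) (reflCircle (b && refl q.1) q.2.1) = y) (by
    rintro _ _ ⟨i, b, z⟩
    refine propext ⟨?_, fun h => ⟨b, rfl, h⟩⟩
    rintro ⟨b', hb, h⟩
    cases endpt_injective hb
    exact h)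
  have hP : P (Quot.mk _ (.inl y)) := rfl
  rw [← h] at hP
  exact hP

namespace Cobordism

variable {S T : Surface} (M : Cobordism S T)

lemma sumElim_injective : Function.Injective (Sum.elim M.psiS M.psiT) := by
  have h (x : S ⊕ T) : Sum.elim M.psiS M.psiT x = M.chart (Quot.mk _ (.inl x)) := by
    cases x <;> rfl
  intro x y hxy
  rw [h, h] at hxy
  exact ClosedUp.mk_inl_injective (M.chart.injective (Subtype.ext hxy))

lemma cyl_endpt (i : Fin M.cyls) (b : Bool) (z : Circle) :
    M.cyl i (z, endpt b) = Sum.elim M.psiS M.psiT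
      (holeCircle S T (M.ends (i, b)) (reflCircle (b && M.refl i) z)) := by
  have h : M.cyl i (z, endpt b) = M.chart (Quot.mk _
      (.inl (holeCircle S T (M.ends (i, b)) (reflCircle (b && M.refl i) z)))) :=
    congrArg (fun q => (M.chart q : M.carrier)) (Quot.sound (.glue i b z))
  rw [h]
  cases holeCircle S T (M.ends (i, b)) (reflCircle (b && M.refl i) z) <;> rfl

lemma isRegular_toTubed : M.toTubed.IsRegular where
  locallyPathConnected := M.locallyPathConnectedSpace
  isClosedEmbedding :=
    (M.psiS.continuous.sumElim M.psiT.continuous).isClosedEmbedding M.sumElim_injective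
  wall_hole := by
    rintro i b _ ⟨⟩ z
    exact M.cyl_endpt i b z
  wall_seam := by rintro _ _ ⟨⟩
  exists_end := by rintro ⟨⟩
  seam_joined := by rintro ⟨⟩

end Cobordism

section Composition

variable {S R T : Surface} (M₂ : Cobordism R T) (M₁ : Cobordism S R)

lemma psiS_ne_psiT (M : Cobordism S T) (x : S) (y : T) : M.psiS x ≠ M.psiT y := fun h =>
  Sum.inl_ne_inr (M.sumElim_injective (a₁ := .inl x) (a₂ := .inr y) h)

/-- A subset of a composite that avoids the intermediate surface. -/
def glueSet (A : Set S) (B : Set T) : Glue M₂ M₁ → Prop :=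
  Quot.lift (Sum.elim (fun x => x ∈ M₁.psiS '' A) (fun x => x ∈ M₂.psiT '' B)) (by
    rintro _ _ ⟨x⟩
    refine propext (iff_of_false ?_ ?_)
    · rintro ⟨y, -, h⟩
      exact psiS_ne_psiT M₁ y x h
    · rintro ⟨y, -, h⟩
      exact psiS_ne_psiT M₂ x y h.symm)

lemma glueSet_iff (A : Set (S ⊕ T)) (x : Glue M₂ M₁) :
    glueSet M₂ M₁ (Sum.inl ⁻¹' A) (Sum.inr ⁻¹' A) x ↔
      x ∈ Sum.elim (comp M₂ M₁).src (comp M₂ M₁).tgt '' A := by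
  constructor
  · obtain ⟨x | x⟩ := x
    · rintro ⟨y, hy, rfl⟩
      exact ⟨.inl y, hy, rfl⟩
    · rintro ⟨y, hy, rfl⟩
      exact ⟨.inr y, hy, rfl⟩
  · rintro ⟨y | y, hy, rfl⟩
    · exact ⟨y, hy, rfl⟩
    · exact ⟨y, hy, rfl⟩

/-- The outer surfaces avoid the glued one, so injectivity and closedness can be checked inside `M₁`
and `M₂`, which are Hausdorff; no separation property of the quotient is needed. -/
lemma isClosedEmbedding_comp :
    Topology.IsClosedEmbedding (Sum.elim (comp M₂ M₁).src (comp M₂ M₁).tgt) := by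
  refine .of_continuous_injective_isClosedMap
    ((comp M₂ M₁).src.continuous.sumElim (comp M₂ M₁).tgt.continuous) ?_ ?_
  · intro x y h
    have hx := (glueSet_iff M₂ M₁ {y} _).2 ⟨y, rfl, h.symm⟩
    rcases x with x | x
    · obtain ⟨x', hx', e⟩ := hx
      rw [← Sum.inl.inj (M₁.sumElim_injective (a₁ := .inl x') (a₂ := .inl x) e)]
      exact hx'
    · obtain ⟨x', hx', e⟩ := hx
      rw [← Sum.inr.inj (M₂.sumElim_injective (a₁ := .inr x') (a₂ := .inr x) e)]
      exact hx'
  · intro A hA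
    have : Sum.elim (comp M₂ M₁).src (comp M₂ M₁).tgt '' A =
        {x : Glue M₂ M₁ | glueSet M₂ M₁ (Sum.inl ⁻¹' A) (Sum.inr ⁻¹' A) x} :=
      Set.ext fun x => (glueSet_iff M₂ M₁ A x).symm
    rw [this]
    refine isQuotientMap_quot_mk.isClosed_preimage.1 (isClosed_sum_iff.2 ⟨?_, ?_⟩)
    · exact ((hA.preimage continuous_inl).isCompact.image M₁.psiS.continuous).isClosed
    · exact ((hA.preimage continuous_inr).isCompact.image M₂.psiT.continuous).isClosed

lemma comp_wall_hole (p : (comp M₂ M₁).pieces) (b : Bool) (h : Holes S T)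
    (hh : (comp M₂ M₁).ends p b = .inl h) (z : Circle) : (comp M₂ M₁).wall p (z, endpt b) =
      Sum.elim (comp M₂ M₁).src (comp M₂ M₁).tgt
        (holeCircle S T h (reflCircle (b && (comp M₂ M₁).refl p) z)) := by
  rcases p with i | i
  · have hw := congrArg (Glue.inl M₂ M₁) (M₁.cyl_endpt i b z)
    change lowerEnd S R T (M₁.ends (i, b)) = .inl h at hh
    rcases he : M₁.ends (i, b) with j | j <;> rw [he] at hh hw <;> cases hh
    exact hw
  · have hw := congrArg (Glue.inr M₂ M₁) (M₂.cyl_endpt i b z)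
    change upperEnd S R T (M₂.ends (i, b)) = .inl h at hh
    rcases he : M₂.ends (i, b) with j | j <;> rw [he] at hh hw <;> cases hh
    exact hw

lemma comp_wall_seam (p : (comp M₂ M₁).pieces) (b : Bool) (j : Fin R.holes)
    (hh : (comp M₂ M₁).ends p b = .inr j) (z : Circle) : (comp M₂ M₁).wall p (z, endpt b) =
      Glue.inl M₂ M₁ (M₁.psiT (R.param (j, reflCircle (b && (comp M₂ M₁).refl p) z))) := by
  rcases p with i | i
  · have hw := congrArg (Glue.inl M₂ M₁) (M₁.cyl_endpt i b z)
    change lowerEnd S R T (M₁.ends (i, b)) = .inr j at hh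
    rcases he : M₁.ends (i, b) with l | l <;> rw [he] at hh hw <;> cases hh
    exact hw
  · have hw := congrArg (Glue.inr M₂ M₁) (M₂.cyl_endpt i b z)
    change upperEnd S R T (M₂.ends (i, b)) = .inr j at hh
    rcases he : M₂.ends (i, b) with l | l <;> rw [he] at hh hw <;> cases hh
    exact hw.trans (Quot.sound (.glue _)).symm

lemma isRegular_comp : (comp M₂ M₁).IsRegular where
  locallyPathConnected := inferInstanceAs (LocallyPathConnectedSpace (Glue M₂ M₁))
  isClosedEmbedding := isClosedEmbedding_comp M₂ M₁
  wall_hole := comp_wall_hole M₂ M₁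
  wall_seam := by
    intro p b j h z y hy
    -- The seam lies on the middle surface, which is disjoint from the outer ones.
    rw [comp_wall_seam M₂ M₁ p b j h z] at hy
    obtain ⟨x, -, hx⟩ := (glueSet_iff M₂ M₁ Set.univ _).2 ⟨y, trivial, hy⟩
    exact psiS_ne_psiT M₁ _ _ hx
  exists_end := by
    intro j
    obtain ⟨⟨i, b⟩, hi⟩ := M₁.ends.surjective (.inr j)
    refine ⟨.inl i, b, ?_⟩
    change lowerEnd S R T (M₁.ends (i, b)) = _
    rw [hi]
    rfl
  seam_joined := by
    -- The point 1 of the circle is fixed by the reflection, so all walls at the seam pass through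
    -- this point.
    refine fun j => ⟨Glue.inl M₂ M₁ (M₁.psiT (R.param (j, 1))), fun p b h => ?_⟩
    rw [comp_wall_seam M₂ M₁ p b j h, reflCircle_one]

lemma glueRel_eq_pushoutRel : GlueRel M₂ M₁ = PushoutRel M₁.psiT M₂.psiS := by
  ext x y
  constructor
  · rintro ⟨z⟩
    exact .glue z
  · rintro ⟨z⟩
    exact .glue z

lemma card_pi0_glue : Nat.card (ZerothHomotopy (Glue M₂ M₁)) =
    Nat.card (Quot (PushoutRel (pi0Map M₁.psiT) (pi0Map M₂.psiS))) := by
  rw [← card_pi0_pushout]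
  exact congrArg (fun r => Nat.card (ZerothHomotopy (Quot r))) (glueRel_eq_pushoutRel M₂ M₁)

lemma ker_Hmap_zero (k : Type u) [Field k] {X Y : Type} [TopologicalSpace X] [TopologicalSpace Y]
    (f : C(X, Y)) : LinearMap.ker (Hmap k 0 f) =
      (LinearMap.ker (Finsupp.lmapDomain k k (pi0Map f))).comap
        (homologyZeroEquiv k X : H k 0 X →ₗ[k] ZerothHomotopy X →₀ k) := by
  ext v
  simp only [Submodule.mem_comap, LinearMap.mem_ker, LinearEquiv.coe_coe]
  rw [← homologyZeroEquiv_Hmap, LinearEquiv.map_eq_zero_iff]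

lemma finrank_W1_inf_W2 (k : Type u) [Field k] :
    Module.finrank k ↥(W1 k M₁ ⊓ W2 k M₂) =
      Module.finrank k ↥(LinearMap.ker (Finsupp.lmapDomain k k (pi0Map M₁.psiT)) ⊓
        LinearMap.ker (Finsupp.lmapDomain k k (pi0Map M₂.psiS))) := by
  rw [W1, W2, ker_Hmap_zero, ker_Hmap_zero, ← Submodule.comap_inf]
  exact LinearEquiv.finrank_eq (LinearEquiv.ofSubmodule' (homologyZeroEquiv k R) _)

lemma mu0_eq (k : Type u) [Field k] :
    mu0 k M₂ M₁ = Module.finrank k ↥(W1 k M₁ ⊓ W2 k M₂) := by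
  have h := finrank_ker_inf_ker k (pi0Map M₁.psiT) (pi0Map M₂.psiS)
  rw [← finrank_W1_inf_W2, ← card_pi0_glue] at h
  rw [mu0, (isRegular_comp M₂ M₁).bettiInt_zero, M₁.isRegular_toTubed.bettiInt_zero,
    M₂.isRegular_toTubed.bettiInt_zero]
  -- The count `h` over ℚ, phrased with the carriers that occur in `bettiInt_zero`.
  have h' : (Module.finrank k ↥(W1 k M₁ ⊓ W2 k M₂) : ℚ) +
      (Nat.card (ZerothHomotopy M₁.toTubed.carrier) +
        Nat.card (ZerothHomotopy M₂.toTubed.carrier)) =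
      Nat.card (ZerothHomotopy (comp M₂ M₁).carrier) + Nat.card (ZerothHomotopy R) := by
    exact_mod_cast h
  linarith

end Composition

end HalfProj

end

theorem lemma2p2 {k : Type*} [Field k] {S R T : HalfProj.Surface}
    (M₁ : HalfProj.Cobordism S R) (M₂ : HalfProj.Cobordism R T) :
    HalfProj.mu0 k M₂ M₁ =
        (Module.finrank k ↥(HalfProj.W1 k M₁ ⊓ HalfProj.W2 k M₂) : ℚ) ∧
      ∃ n : ℕ, HalfProj.mu0 k M₂ M₁ = n :=
  ⟨HalfProj.mu0_eq M₂ M₁ k, _, HalfProj.mu0_eq M₂ M₁ k⟩
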